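/- Let $s>2$ be an integer, $A=\{0,1,\dots,s-1\}$ and $A_0=A\setminus\{0\}$. Let $\tilde S\subset[0,1]$ be the set of all numbers $x=\sum_{n\ge 1} d_n s^{-n}$ ($d_n\in A$) whose $s$-adic representation $d_1d_2d_3\dots$ is an infinite concatenation of combinations of digits of the form $\underbrace{u\dots u}_{c-1}c$ with $u\in A$, $c\in A_0$, $c\ne u$ (both $u$ and $c$ may change from one combination to the next). Then $\tilde S$ is a self-similar fractal, and its Hausdorff dimension $\alpha_0$ satisfies $$\left(\frac1s\right)^{\alpha_0}+(s-1)\left(\frac1s\right)^{2\alpha_0}+(s-1)\left(\frac1s\right)^{3\alpha_0}+\dots+(s-1)\left(\frac1s\right)^{(s-1)\alpha_0}=1.$$ Here "self-similar" means that $\tilde S$ is nonempty, compact, and the union of its images under finitely many (at least two) contracting similarities of $\mathbb R$, that its $\alpha_0$-dimensional Hausdorff measure is positive, and that this measure vanishes on the intersection of any two different ones of these images; "fractal" means both that the topological dimension of $\tilde S$ differs from $\alpha_0$ and that $\alpha_0$ is not an integer. -/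

import Mathlib

open MeasureTheory
open scoped ENNReal NNReal

/-- The combination `u…uc` of digits: `c - 1` copies of `u`, followed by `c`. -/
def digitBlock {s : ℕ} (u c : Fin s) : List (Fin s) :=
  List.replicate ((c : ℕ) - 1) u ++ [c]

/-- The admissible combinations of `s`-adic digits: all `u…uc` with `c ≠ 0` and `c ≠ u`. -/
def admissibleBlocks (s : ℕ) : Set (List (Fin s)) :=
  {w | ∃ u c : Fin s, (c : ℕ) ≠ 0 ∧ c ≠ u ∧ w = digitBlock u c}

/-- The infinite word `d` is a concatenation of (nonempty) finite words from `W`: there are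
cutting positions `0 = t 0 < t 1 < t 2 < ⋯` such that each of the words
`d (t n), …, d (t (n + 1) - 1)` belongs to `W`. -/
def IsConcatenationOf {A : Type*} (W : Set (List A)) (d : ℕ → A) : Prop :=
  ∃ t : ℕ → ℕ, t 0 = 0 ∧ StrictMono t ∧
    ∀ n, (List.Ico (t n) (t (n + 1))).map d ∈ W

/-- The set of all numbers having an `s`-adic representation
`d 0 / s + d 1 / s ^ 2 + d 2 / s ^ 3 + ⋯` that consists only of admissible combinations
of digits. -/
def tildeS (s : ℕ) : Set ℝ :=
  {x | ∃ d : ℕ → Fin s, IsConcatenationOf (admissibleBlocks s) d ∧ x = Real.ofDigits d}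

/-- `K` is self-similar: a nonempty compact set which is the union of its images under finitely
many (at least two) contracting similarities, the images overlapping only negligibly, i.e.
`K` has positive `D`-dimensional Hausdorff measure and the overlaps have measure zero,
where `D` is the Hausdorff dimension of `K`. -/
def IsSelfSimilar (K : Set ℝ) : Prop :=
  K.Nonempty ∧ IsCompact K ∧
    ∃ (m : ℕ) (f : Fin m → ℝ → ℝ) (r : Fin m → ℝ),
      2 ≤ m ∧
      (∀ i, 0 < r i ∧ r i < 1) ∧
      (∀ i x y, dist (f i x) (f i y) = r i * dist x y) ∧
      K = ⋃ i, f i '' K ∧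
      0 < Measure.hausdorffMeasure (dimH K).toReal K ∧
      ∀ i j, i ≠ j → Measure.hausdorffMeasure (dimH K).toReal (f i '' K ∩ f j '' K) = 0

/-- `K` is a fractal in the wide sense: its topological dimension differs from its
Hausdorff dimension. -/
def IsFractalWide (K : Set ℝ) : Prop :=
  (smallInductiveDimension K).map ENat.toENNReal ≠ (dimH K : WithBot ℝ≥0∞)

/-- `K` is a fractal in the narrow sense: its Hausdorff dimension is fractional,
i.e. a real number that is not an integer. -/
def IsFractalNarrow (K : Set ℝ) : Prop :=
  dimH K ≠ ∞ ∧ ∀ n : ℕ, dimH K ≠ (n : ℝ≥0∞)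

/-! Prepending a block `u…uc` acts on values as a similarity of ratio `s⁻ᶜ`, and the set is the
union of its images under these finitely many maps. The block of length one is the single digit 1,
whatever `u` is; for each length `c ≥ 2` there are `s - 1` choices of `u`. So the equation is
Moran's equation of this system, and it remains to see that the images are disjoint.

The blocks do not form a prefix code: `1` is a prefix of `1…1c`. Nevertheless an infinite
concatenation determines its first block (`StartsWithBlock.length_le_of_mem`); the crux is
`not_mem_admissibleSequences_tail`: a concatenation beginning with a digit at least 2 stops being
one when that digit is removed. Since every block ends in a nonzero digit, no concatenation is
eventually zero, so its value determines its digits (`eq_of_ofDigits_eq`).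

Disjoint compact images give strong separation, and `dimH_eq_of_ifs` yields the dimension and the
positivity of the measure: natural covers bound the measure above, a Bernoulli measure bounds it
below. Finally the root lies strictly between 0 and 1, hence is not an integer and cannot equal a
topological dimension. -/

open Filter Topology

/-! ### Iterated function systems of similarities and Moran's formula -/

/-- The cell of an iterated function system that is addressed by a finite word. -/
def ifsCell {X I : Type*} (f : I → X → X) (K : Set X) : (n : ℕ) → (Fin n → I) → Set X
  | 0, _ => K
  | n + 1, w => f (w 0) '' ifsCell f K n (Fin.tail w)

/-- The `n`-th approximation to the point with address `ω`. -/
def ifsApprox {X I : Type*} (f : I → X → X) (x₀ : X) : ℕ → (ℕ → I) → X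
  | 0, _ => x₀
  | n + 1, ω => f (ω 0) (ifsApprox f x₀ n fun k => ω (k + 1))

theorem subset_iUnion_ifsCell {X I : Type*} {f : I → X → X} {K : Set X}
    (hK : K ⊆ ⋃ i, f i '' K) (n : ℕ) : K ⊆ ⋃ w, ifsCell f K n w := by
  induction n with
  | zero => intro x hx; exact Set.mem_iUnion.2 ⟨Fin.elim0, hx⟩
  | succ n ih =>
    intro x hx
    obtain ⟨i, y, hy, rfl⟩ := Set.mem_iUnion.1 (hK hx)
    obtain ⟨w, hw⟩ := Set.mem_iUnion.1 (ih hy)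
    exact Set.mem_iUnion.2 ⟨Fin.cons i w, y, by simpa using hw, by simp⟩

section IFS

variable {X I : Type*} [MetricSpace X] {f : I → X → X} {r : I → ℝ} {K : Set X}

theorem dist_le_of_mem_ifsCell (hr : ∀ i, 0 < r i)
    (hf : ∀ i x y, dist (f i x) (f i y) = r i * dist x y) {D : ℝ}
    (hD : ∀ x ∈ K, ∀ y ∈ K, dist x y ≤ D) (n : ℕ) (w : Fin n → I) :
    ∀ x ∈ ifsCell f K n w, ∀ y ∈ ifsCell f K n w, dist x y ≤ (∏ i, r (w i)) * D := by
  induction n with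
  | zero => simpa [ifsCell] using hD
  | succ n ih =>
    rintro _ ⟨x, hx, rfl⟩ _ ⟨y, hy, rfl⟩
    rw [hf, Fin.prod_univ_succ, mul_assoc]
    exact mul_le_mul_of_nonneg_left (ih _ x hx y hy) (hr _).le

theorem sum_prod_rpow_eq_one [Fintype I] (hr : ∀ i, 0 < r i) {α : ℝ} (hsum : ∑ i, r i ^ α = 1)
    (n : ℕ) : ∑ w : Fin n → I, (∏ i, r (w i)) ^ α = 1 := by
  have h := Fintype.sum_pow (fun i => r i ^ α) n
  rw [hsum, one_pow] at h
  rw [h]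
  exact Finset.sum_congr rfl fun w _ =>
    (Real.finsetProd_rpow _ _ (fun i _ => (hr _).le) _).symm

theorem exists_uniform_ratio [Finite I] (hr : ∀ i, 0 < r i) (hr1 : ∀ i, r i < 1) :
    ∃ ρ : ℝ, 0 < ρ ∧ ρ < 1 ∧ ∀ i, r i ≤ ρ := by
  cases isEmpty_or_nonempty I
  · exact ⟨1 / 2, by norm_num, by norm_num, fun i => isEmptyElim i⟩
  · obtain ⟨i, hi⟩ := Finite.exists_max r
    exact ⟨r i, hr i, hr1 i, hi⟩

/-- The cells of level `n` cover `K`, their diameters tend to 0 uniformly, and by Moran's equation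
the sum of their `α`-th powers never exceeds `D ^ α`. -/
theorem hausdorffMeasure_ne_top_of_ifs [Fintype I] [MeasurableSpace X] [BorelSpace X]
    (hr : ∀ i, 0 < r i) (hr1 : ∀ i, r i < 1)
    (hf : ∀ i x y, dist (f i x) (f i y) = r i * dist x y) (hKb : Bornology.IsBounded K)
    (hK : K ⊆ ⋃ i, f i '' K) {α : ℝ} (hα : 0 ≤ α) (hsum : ∑ i, r i ^ α = 1) :
    Measure.hausdorffMeasure α K ≠ ∞ := by
  obtain ⟨ρ, hρ0, hρ1, hρ⟩ := exists_uniform_ratio hr hr1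
  set D := Metric.diam K
  have hD0 : 0 ≤ D := Metric.diam_nonneg
  have hD : ∀ x ∈ K, ∀ y ∈ K, dist x y ≤ D := fun x hx y hy => Metric.dist_le_diam_of_mem hKb hx hy
  have hpos : ∀ n (w : Fin n → I), 0 ≤ ∏ i, r (w i) :=
    fun n w => Finset.prod_nonneg fun i _ => (hr _).le
  have hdiam : ∀ n (w : Fin n → I),
      Metric.ediam (ifsCell f K n w) ≤ ENNReal.ofReal ((∏ i, r (w i)) * D) := by
    intro n w
    refine Metric.ediam_le fun x hx y hy => ?_
    rw [edist_dist]
    exact ENNReal.ofReal_le_ofReal (dist_le_of_mem_ifsCell hr hf hD n w x hx y hy)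
  have hsumle : ∀ n, ∑ w, Metric.ediam (ifsCell f K n w) ^ α ≤ ENNReal.ofReal (D ^ α) := by
    intro n
    calc ∑ w, Metric.ediam (ifsCell f K n w) ^ α
        ≤ ∑ w : Fin n → I, ENNReal.ofReal ((∏ i, r (w i)) ^ α * D ^ α) := by
          refine Finset.sum_le_sum fun w _ => ?_
          rw [← Real.mul_rpow (hpos n w) hD0, ← ENNReal.ofReal_rpow_of_nonneg
            (mul_nonneg (hpos n w) hD0) hα]
          exact ENNReal.rpow_le_rpow (hdiam n w) hα
      _ = ENNReal.ofReal (D ^ α) := by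
          rw [← ENNReal.ofReal_sum_of_nonneg, ← Finset.sum_mul, sum_prod_rpow_eq_one hr hsum,
            one_mul]
          exact fun w _ => mul_nonneg (Real.rpow_nonneg (hpos n w) _) (Real.rpow_nonneg hD0 _)
  have key := Measure.hausdorffMeasure_le_liminf_sum (ι := fun n : ℕ => Fin n → I) α K
    (l := atTop) (fun n => ENNReal.ofReal (ρ ^ n * D))
    (by
      have := ((tendsto_pow_atTop_nhds_zero_of_lt_one hρ0.le hρ1).mul_const D)
      rw [zero_mul] at this
      simpa using ENNReal.tendsto_ofReal this)
    (fun n w => ifsCell f K n w)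
    (Eventually.of_forall fun n w => (hdiam n w).trans (ENNReal.ofReal_le_ofReal
      (mul_le_mul_of_nonneg_right (by
        calc ∏ i, r (w i) ≤ ∏ _i : Fin n, ρ :=
              Finset.prod_le_prod (fun i _ => (hr _).le) fun i _ => hρ _
          _ = ρ ^ n := by simp) hD0)))
    (Eventually.of_forall fun n => subset_iUnion_ifsCell hK n)
  refine ne_top_of_le_ne_top (ENNReal.ofReal_ne_top (r := D ^ α)) (key.trans ?_)
  exact (liminf_le_liminf (Eventually.of_forall hsumle)).trans (liminf_const _).le

/-- The coding map of an iterated function system of contracting similarities. -/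
theorem exists_ifs_coding (hKc : IsCompact K) (hKn : K.Nonempty) {ρ : ℝ} (hρ : ρ < 1)
    (hr : ∀ i, 0 < r i) (hrρ : ∀ i, r i ≤ ρ)
    (hf : ∀ i x y, dist (f i x) (f i y) = r i * dist x y) (hmaps : ∀ i, f i '' K ⊆ K) :
    ∃ π : (ℕ → I) → X, ∀ ω, π ω ∈ K ∧ π ω = f (ω 0) (π fun k => ω (k + 1)) := by
  obtain ⟨x₀, hx₀⟩ := hKn
  have hmem : ∀ n ω, ifsApprox f x₀ n ω ∈ K := by
    intro n
    induction n with
    | zero => exact fun _ => hx₀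
    | succ n ih => exact fun ω => hmaps _ ⟨_, ih _, rfl⟩
  have hdist : ∀ n ω,
      dist (ifsApprox f x₀ n ω) (ifsApprox f x₀ (n + 1) ω) ≤ Metric.diam K * ρ ^ n := by
    intro n
    induction n with
    | zero =>
      intro ω
      simpa using Metric.dist_le_diam_of_mem hKc.isBounded (hmem 0 ω) (hmem 1 ω)
    | succ n ih =>
      intro ω
      calc _ = r (ω 0) * dist (ifsApprox f x₀ n fun k => ω (k + 1))
              (ifsApprox f x₀ (n + 1) fun k => ω (k + 1)) := hf _ _ _
        _ ≤ ρ * (Metric.diam K * ρ ^ n) :=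
          mul_le_mul (hrρ _) (ih _) dist_nonneg ((hr (ω 0)).le.trans (hrρ _))
        _ = _ := by ring
  have hlim : ∀ ω, ∃ x ∈ K, Tendsto (fun n => ifsApprox f x₀ n ω) atTop (𝓝 x) := fun ω =>
    cauchySeq_tendsto_of_isComplete hKc.isComplete (fun n => hmem n ω)
      (cauchySeq_of_le_geometric ρ _ hρ fun n => hdist n ω)
  choose π hπ hπlim using hlim
  refine ⟨π, fun ω => ⟨hπ ω, ?_⟩⟩
  have hcont : Continuous (f (ω 0)) :=
    (LipschitzWith.of_dist_le_mul (K := ⟨r (ω 0), (hr _).le⟩) fun x y => (hf _ x y).le).continuous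
  exact tendsto_nhds_unique ((tendsto_add_atTop_iff_nat 1).2 (hπlim ω))
    ((hcont.tendsto _).comp (hπlim fun k => ω (k + 1)))

/-- A common prefix of two addresses applies the same similarities to both points, so it scales the
distance exactly. -/
theorem dist_coding_eq (hf : ∀ i x y, dist (f i x) (f i y) = r i * dist x y)
    {π : (ℕ → I) → X} (hπ : ∀ ω, π ω = f (ω 0) (π fun k => ω (k + 1))) (n : ℕ) :
    ∀ ω ω' : ℕ → I, (∀ k < n, ω k = ω' k) →
      dist (π ω) (π ω') = (∏ k ∈ Finset.range n, r (ω k)) *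
        dist (π fun k => ω (k + n)) (π fun k => ω' (k + n)) := by
  induction n with
  | zero => simp
  | succ n ih =>
    intro ω ω' h
    rw [hπ ω, hπ ω', h 0 n.succ_pos, hf, ih _ _ fun k hk => h (k + 1) (by lia),
      Finset.prod_range_succ', h 0 n.succ_pos]
    simp only [add_assoc, Nat.add_comm n 1]
    ring

theorem exists_separation_of_pairwise_disjoint [Finite I] {E : I → Set X}
    (hE : ∀ i, IsCompact (E i)) (hd : Pairwise fun i j => Disjoint (E i) (E j)) :
    ∃ δ : ℝ, 0 < δ ∧ ∀ i j, i ≠ j → ∀ x ∈ E i, ∀ y ∈ E j, δ ≤ dist x y := by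
  have h : ∀ p : I × I, ∃ δ : ℝ, 0 < δ ∧
      (p.1 ≠ p.2 → ∀ x ∈ E p.1, ∀ y ∈ E p.2, δ ≤ dist x y) := by
    rintro ⟨i, j⟩
    by_cases hij : i = j
    · exact ⟨1, one_pos, fun h => absurd hij h⟩
    · obtain ⟨δ, h0, h1⟩ := Metric.exists_pos_forall_lt_edist (hE i) (hE j).isClosed (hd hij)
      refine ⟨δ, h0, fun _ x hx y hy => ?_⟩
      have := h1 x hx y hy
      rw [edist_nndist, ENNReal.coe_lt_coe] at this
      exact_mod_cast this.le
  choose δ hδ0 hδ using h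
  cases isEmpty_or_nonempty I
  · exact ⟨1, one_pos, fun i => isEmptyElim i⟩
  · obtain ⟨p, hp⟩ := Finite.exists_min δ
    exact ⟨δ p, hδ0 p, fun i j hij x hx y hy => (hp (i, j)).trans (hδ (i, j) hij x hx y hy)⟩

/-- Mass distribution principle: the Bernoulli measure with weights `r i ^ α`, transported by the
coding map, gives each set mass at most a constant times its diameter to the power `α`. -/
theorem hausdorffMeasure_pos_of_ifs [Fintype I] [MeasurableSpace X] [BorelSpace X]
    (hr : ∀ i, 0 < r i) (hr1 : ∀ i, r i < 1)
    (hf : ∀ i x y, dist (f i x) (f i y) = r i * dist x y) (hKc : IsCompact K) (hKn : K.Nonempty)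
    (hmaps : ∀ i, f i '' K ⊆ K) (hdisj : Pairwise fun i j => Disjoint (f i '' K) (f j '' K))
    {α : ℝ} (hα : 0 < α) (hsum : ∑ i, r i ^ α = 1) :
    0 < Measure.hausdorffMeasure α K := by
  obtain ⟨ρ, hρ0, hρ1, hρ⟩ := exists_uniform_ratio hr hr1
  obtain ⟨π, hπ⟩ := exists_ifs_coding hKc hKn hρ1 hr hρ hf hmaps
  have hcont : ∀ i, Continuous (f i) := fun i =>
    (LipschitzWith.of_dist_le_mul (K := ⟨r i, (hr i).le⟩) fun x y => (hf _ x y).le).continuous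
  obtain ⟨δ, hδ0, hδ⟩ := exists_separation_of_pairwise_disjoint
    (fun i => hKc.image (hcont i)) hdisj
  have hdist := dist_coding_eq hf fun ω => (hπ ω).2
  have hprod : ∀ n (ω : ℕ → I), 0 ≤ ∏ k ∈ Finset.range n, r (ω k) :=
    fun n ω => Finset.prod_nonneg fun i _ => (hr _).le
  have hprodρ : ∀ n (ω : ℕ → I), ∏ k ∈ Finset.range n, r (ω k) ≤ ρ ^ n := fun n ω => by
    calc ∏ k ∈ Finset.range n, r (ω k) ≤ ∏ _k ∈ Finset.range n, ρ :=
          Finset.prod_le_prod (fun i _ => (hr _).le) fun i _ => hρ _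
      _ = ρ ^ n := by simp
  -- The discrete structure on the alphabet makes the address space a product on which the coding
  -- map is continuous, hence measurable.
  let _ : TopologicalSpace I := ⊥
  have : DiscreteTopology I := ⟨rfl⟩
  let _ : MeasurableSpace I := ⊤
  have : MeasurableSingletonClass I := ⟨fun _ => trivial⟩
  have : BorelSpace I := ⟨borel_eq_top_of_discrete.symm⟩
  have hπcont : Continuous π := by
    rw [continuous_iff_continuousAt]
    intro ω
    rw [ContinuousAt, Metric.tendsto_nhds]
    intro ε hε
    have hlim := (tendsto_pow_atTop_nhds_zero_of_lt_one hρ0.le hρ1).mul_const (Metric.diam K)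
    rw [zero_mul] at hlim
    obtain ⟨n, hn⟩ := (hlim.eventually (gt_mem_nhds hε)).exists
    have hev : ∀ᶠ ω' in 𝓝 ω, ∀ k ∈ Finset.range n, ω' k = ω k := by
      rw [Filter.eventually_all_finset]
      intro k _
      exact ((continuous_apply k).tendsto ω).eventually
        ((isOpen_discrete {ω k}).mem_nhds rfl)
    filter_upwards [hev] with ω' hω'
    rw [hdist n ω' ω fun k hk => hω' k (Finset.mem_range.2 hk)]
    exact (mul_le_mul (hprodρ n _) (Metric.dist_le_diam_of_mem hKc.isBounded (hπ _).1 (hπ _).1)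
      dist_nonneg (pow_nonneg hρ0.le n)).trans_lt hn
  have hsum' : ∑ i, ENNReal.ofReal (r i ^ α) = 1 := by
    rw [← ENNReal.ofReal_sum_of_nonneg fun i _ => Real.rpow_nonneg (hr i).le α, hsum,
      ENNReal.ofReal_one]
  let p : PMF I := PMF.ofFintype (fun i => ENNReal.ofReal (r i ^ α)) hsum'
  let μ : Measure (ℕ → I) := Measure.infinitePi fun _ => p.toMeasure
  have hcyl : ∀ n (ω : ℕ → I) (V : Set (ℕ → I)), (∀ ω' ∈ V, ∀ k < n, ω' k = ω k) →
      μ V ≤ ENNReal.ofReal ((∏ k ∈ Finset.range n, r (ω k)) ^ α) := by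
    intro n ω V hV
    calc μ V ≤ μ (Set.pi (Finset.range n) fun k => {ω k}) :=
          measure_mono fun ω' hω' k hk => hV ω' hω' k (Finset.mem_range.1 hk)
      _ = ∏ k ∈ Finset.range n, p.toMeasure {ω k} :=
          Measure.infinitePi_pi _ fun k _ => measurableSet_singleton _
      _ = _ := by
          rw [← Real.finsetProd_rpow _ _ (fun i _ => (hr _).le),
            ENNReal.ofReal_prod_of_nonneg fun i _ => Real.rpow_nonneg (hr _).le _]
          refine Finset.prod_congr rfl fun k _ => ?_
          rw [PMF.toMeasure_apply_singleton _ _ (measurableSet_singleton _)]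
          rfl
  have hμV : ∀ V : Set X, ENNReal.ofReal (δ ^ α) * μ (π ⁻¹' V) ≤ Metric.ediam V ^ α := by
    intro V
    -- At the first index `n` where two addresses in the preimage differ, the preimage lies in one
    -- cylinder of length `n`, while separation keeps two points of `V` at distance at least `δ`
    -- times the ratio of that cylinder.
    by_cases hex : ∃ n, ∃ ω ∈ π ⁻¹' V, ∃ ω' ∈ π ⁻¹' V, ω n ≠ ω' n
    · classical
      obtain ⟨ω, hω, ω', hω', hne⟩ := Nat.find_spec hex
      set n := Nat.find hex with hn
      have hmin : ∀ k < n, ∀ ω₁ ∈ π ⁻¹' V, ∀ ω₂ ∈ π ⁻¹' V, ω₁ k = ω₂ k := by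
        intro k hk ω₁ h₁ ω₂ h₂
        by_contra h
        exact Nat.find_min hex hk ⟨ω₁, h₁, ω₂, h₂, h⟩
      have hle : δ * ∏ k ∈ Finset.range n, r (ω k) ≤ dist (π ω) (π ω') := by
        rw [hdist n ω ω' fun k hk => hmin k hk ω hω ω' hω', mul_comm]
        refine mul_le_mul_of_nonneg_left (hδ (ω n) (ω' n) hne _ ?_ _ ?_) (hprod n ω)
        · exact ⟨_, (hπ fun k => ω (k + 1 + n)).1, by
            simpa using (hπ fun k => ω (k + n)).2.symm⟩
        · exact ⟨_, (hπ fun k => ω' (k + 1 + n)).1, by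
            simpa using (hπ fun k => ω' (k + n)).2.symm⟩
      calc ENNReal.ofReal (δ ^ α) * μ (π ⁻¹' V)
          ≤ ENNReal.ofReal (δ ^ α) * ENNReal.ofReal ((∏ k ∈ Finset.range n, r (ω k)) ^ α) :=
            mul_le_mul_right (hcyl n ω _ fun ω₁ h₁ k hk => hmin k hk ω₁ h₁ ω hω) _
        _ = ENNReal.ofReal (δ * ∏ k ∈ Finset.range n, r (ω k)) ^ α := by
            rw [← ENNReal.ofReal_mul (Real.rpow_nonneg hδ0.le _),
              ← Real.mul_rpow hδ0.le (hprod n ω),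
              ENNReal.ofReal_rpow_of_nonneg (mul_nonneg hδ0.le (hprod n ω)) hα.le]
        _ ≤ Metric.ediam V ^ α := by
            refine ENNReal.rpow_le_rpow ?_ hα.le
            refine le_trans ?_ (Metric.edist_le_ediam_of_mem hω hω')
            rw [edist_dist]
            exact ENNReal.ofReal_le_ofReal hle
    -- Now the preimage has at most one address, and the Bernoulli measure has no atoms.
    · push Not at hex
      have h0 : μ (π ⁻¹' V) = 0 := by
        rcases (π ⁻¹' V).eq_empty_or_nonempty with h | ⟨ω, hω⟩
        · rw [h, measure_empty]
        have hle : ∀ n : ℕ, μ (π ⁻¹' V) ≤ ENNReal.ofReal ((ρ ^ n) ^ α) := fun n =>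
          (hcyl n ω _ fun ω' hω' k _ => hex k ω' hω' ω hω).trans (ENNReal.ofReal_le_ofReal
            (Real.rpow_le_rpow (hprod n ω) (hprodρ n ω) hα.le))
        have hlim : Tendsto (fun n : ℕ => ENNReal.ofReal ((ρ ^ n) ^ α)) atTop (𝓝 0) := by
          have := (tendsto_pow_atTop_nhds_zero_of_lt_one hρ0.le hρ1).rpow_const (p := α)
            (Or.inr hα.le)
          rw [Real.zero_rpow hα.ne'] at this
          simpa using ENNReal.tendsto_ofReal this
        exact le_antisymm (ge_of_tendsto' hlim hle) zero_le
      simp [h0]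
  have hν : ENNReal.ofReal (δ ^ α) • μ.map π ≤ Measure.hausdorffMeasure α := by
    refine Measure.le_hausdorffMeasure α _ 1 one_pos fun V _ => ?_
    -- Passing to the closure makes the set measurable without changing its diameter.
    rw [Measure.smul_apply, smul_eq_mul, ← Metric.ediam_closure V]
    refine (mul_le_mul_right (measure_mono subset_closure) _).trans ?_
    rw [Measure.map_apply hπcont.measurable isClosed_closure.measurableSet]
    exact hμV _
  refine lt_of_lt_of_le ?_ (hν K)
  have hpre : π ⁻¹' K = Set.univ := Set.eq_univ_of_forall fun ω => (hπ ω).1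
  rw [Measure.smul_apply, Measure.map_apply hπcont.measurable hKc.measurableSet, hpre,
    measure_univ, smul_eq_mul, mul_one, ENNReal.ofReal_pos]
  exact Real.rpow_pos_of_pos hδ0 _

/-- Moran's formula under the strong separation condition. -/
theorem dimH_eq_of_ifs [Fintype I] [MeasurableSpace X] [BorelSpace X]
    (hr : ∀ i, 0 < r i) (hr1 : ∀ i, r i < 1)
    (hf : ∀ i x y, dist (f i x) (f i y) = r i * dist x y) (hKc : IsCompact K) (hKn : K.Nonempty)
    (hK : K = ⋃ i, f i '' K) (hdisj : Pairwise fun i j => Disjoint (f i '' K) (f j '' K))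
    {α : ℝ≥0} (hα : 0 < α) (hsum : ∑ i, r i ^ (α : ℝ) = 1) :
    dimH K = α ∧ 0 < Measure.hausdorffMeasure (α : ℝ) K := by
  have hpos := hausdorffMeasure_pos_of_ifs hr hr1 hf hKc hKn
    (fun i => by conv_rhs => rw [hK]
                 exact Set.subset_iUnion (fun i => f i '' K) i) hdisj
    (NNReal.coe_pos.2 hα) hsum
  exact ⟨dimH_of_hausdorffMeasure_ne_zero_ne_top hpos.ne'
    (hausdorffMeasure_ne_top_of_ifs hr hr1 hf hKc.isBounded hK.subset α.2 hsum), hpos⟩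

end IFS

/-! ### Infinite concatenations of words -/

section Words

variable {A : Type*} {W : Set (List A)}

theorem map_listIco_eq_map_range (d : ℕ → A) (a b : ℕ) :
    (List.Ico a b).map d = (List.range (b - a)).map fun k => d (k + a) := by
  rw [List.Ico, List.range'_eq_map_range, List.map_map]
  exact List.map_congr_left fun k _ => by simp [Nat.add_comm]

/-- A concatenation starts with a word, followed by a concatenation. -/
theorem IsConcatenationOf.exists_head_tail {d : ℕ → A} (hd : IsConcatenationOf W d) :
    ∃ l, 0 < l ∧ (List.range l).map d ∈ W ∧ IsConcatenationOf W fun k => d (k + l) := by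
  obtain ⟨t, h0, hmono, ht⟩ := hd
  have hle : ∀ n, t 1 ≤ t (n + 1) := fun n => hmono.monotone (by lia)
  refine ⟨t 1, by simpa [h0] using hmono zero_lt_one, ?_, fun n => t (n + 1) - t 1, by simp,
    fun m n hmn => ?_, fun n => ?_⟩
  · simpa [h0, map_listIco_eq_map_range] using ht 0
  · have := hmono (Nat.add_lt_add_right hmn 1)
    have := hle m
    dsimp only
    lia
  · have h := ht (n + 1)
    have h1 := hle n
    have h2 := hle (n + 1)
    rw [map_listIco_eq_map_range] at h ⊢
    have e : t (n + 1 + 1) - t 1 - (t (n + 1) - t 1) = t (n + 1 + 1) - t (n + 1) := by lia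
    rw [e]
    convert h using 4
    lia

/-- Coinduction for concatenations. -/
theorem isConcatenationOf_of_coinduction {P : Set (ℕ → A)}
    (hP : ∀ d ∈ P, ∃ l, 0 < l ∧ (List.range l).map d ∈ W ∧ (fun k => d (k + l)) ∈ P)
    {d : ℕ → A} (hd : d ∈ P) : IsConcatenationOf W d := by
  choose! l hl hW hl' using hP
  -- `e n` is what remains after `n` words are cut off; below, `t n` is their total length.
  let e : ℕ → ℕ → A := fun n => Nat.rec d (fun _ e k => e (k + l e)) n
  have he : ∀ n, e n ∈ P := fun n => by
    induction n with
    | zero => exact hd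
    | succ n ih => exact hl' _ ih
  let t : ℕ → ℕ := fun n => ∑ i ∈ Finset.range n, l (e i)
  have hte : ∀ n, e n = fun k => d (k + t n) := fun n => by
    induction n with
    | zero => simp [e, t]
    | succ n ih =>
      funext k
      change e n (k + l (e n)) = _
      conv_lhs => rw [ih]
      simp only [t, Finset.sum_range_succ]
      congr 1
      rw [← ih]
      lia
  refine ⟨t, by simp [t], strictMono_nat_of_lt_succ fun n => ?_, fun n => ?_⟩
  · simpa [t, Finset.sum_range_succ] using hl _ (he n)
  · have h := hW _ (he n)
    have e1 : t (n + 1) - t n = l (e n) := by simp [t, Finset.sum_range_succ]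
    rw [map_listIco_eq_map_range, e1, ← hte]
    exact h

end Words

/-! ### Admissible blocks and unique decoding -/

section Blocks

variable {s : ℕ}

/-- The digit sequence `u…uc` followed by `d`. -/
def prependBlock (u c : Fin s) (d : ℕ → Fin s) : ℕ → Fin s := fun i =>
  if i + 1 < c then u else if i + 1 = c then c else d (i - c)

/-- The digit sequences that are concatenations of admissible blocks. -/
def admissibleSequences (s : ℕ) : Set (ℕ → Fin s) :=
  {d | IsConcatenationOf (admissibleBlocks s) d}

/-- `d` starts with the admissible block `u…uc`. -/
def StartsWithBlock (u c : Fin s) (d : ℕ → Fin s) : Prop :=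
  (c : ℕ) ≠ 0 ∧ c ≠ u ∧ (∀ i, i + 1 < (c : ℕ) → d i = u) ∧ d ((c : ℕ) - 1) = c

theorem map_range_eq_digitBlock {u c : Fin s} (hc : (c : ℕ) ≠ 0) {d : ℕ → Fin s}
    (hu : ∀ i, i + 1 < (c : ℕ) → d i = u) (hd : d ((c : ℕ) - 1) = c) :
    (List.range c).map d = digitBlock u c := by
  obtain ⟨m, hm⟩ := Nat.exists_eq_succ_of_ne_zero hc
  rw [digitBlock, hm, List.range_succ, List.map_append]
  rw [hm] at hu hd
  simp only [Nat.succ_eq_add_one, Nat.add_sub_cancel, List.map_cons, List.map_nil] at hd ⊢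
  rw [hd]
  congr 1
  refine List.eq_replicate_iff.2 ⟨by simp, fun b hb => ?_⟩
  obtain ⟨i, hi, rfl⟩ := List.mem_map.1 hb
  exact hu i (by simpa using hi)

theorem length_digitBlock {u c : Fin s} (hc : (c : ℕ) ≠ 0) : (digitBlock u c).length = c := by
  simp only [digitBlock, List.length_append, List.length_replicate, List.length_singleton]
  lia

theorem startsWithBlock_of_map_range {u c : Fin s} (hc : (c : ℕ) ≠ 0) (hcu : c ≠ u)
    {d : ℕ → Fin s} (h : (List.range c).map d = digitBlock u c) : StartsWithBlock u c d := by
  have hget : ∀ i, i < (c : ℕ) → some (d i) = (digitBlock u c)[i]? := fun i hi => by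
    rw [← h]; simp [hi]
  refine ⟨hc, hcu, fun i hi => ?_, ?_⟩
  · have := hget i (by lia)
    rw [digitBlock, List.getElem?_append_left (by simp; lia)] at this
    have h2 : i < (c : ℕ) - 1 := by lia
    simpa [h2] using this
  · have := hget (c - 1) (by lia)
    rw [digitBlock, List.getElem?_append_right (by simp)] at this
    simpa using this

theorem admissibleSequences_step {d : ℕ → Fin s} (hd : d ∈ admissibleSequences s) :
    ∃ u c : Fin s, StartsWithBlock u c d ∧ (fun k => d (k + c)) ∈ admissibleSequences s := by
  obtain ⟨l, -, ⟨u, c, hc, hcu, hw⟩, ht⟩ := IsConcatenationOf.exists_head_tail hd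
  have hl : l = c := by
    have := congrArg List.length hw
    rwa [length_digitBlock hc, List.length_map, List.length_range] at this
  subst hl
  exact ⟨u, c, startsWithBlock_of_map_range hc hcu hw, ht⟩

/-- The admissible sequences form the largest set whose members all split into a block followed by a
member; this avoids handling cutting positions. -/
theorem admissibleSequences_of_coinduction {P : Set (ℕ → Fin s)}
    (hP : ∀ d ∈ P, ∃ u c : Fin s, StartsWithBlock u c d ∧ (fun k => d (k + c)) ∈ P) :
    P ⊆ admissibleSequences s := by
  refine fun d hd => isConcatenationOf_of_coinduction (P := P) (fun d hd => ?_) hd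
  obtain ⟨u, c, ⟨hc, hcu, hu, hdc⟩, ht⟩ := hP d hd
  exact ⟨c, Nat.pos_of_ne_zero hc, ⟨u, c, hc, hcu, map_range_eq_digitBlock hc hu hdc⟩, ht⟩

theorem admissibleSequences_of_step {d : ℕ → Fin s} {u c : Fin s} (h : StartsWithBlock u c d)
    (ht : (fun k => d (k + c)) ∈ admissibleSequences s) : d ∈ admissibleSequences s := by
  refine admissibleSequences_of_coinduction (P := insert d (admissibleSequences s)) ?_
    (Set.mem_insert _ _)
  rintro e (rfl | he)
  · exact ⟨u, c, h, Or.inr ht⟩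
  · obtain ⟨u', c', h1, h2⟩ := admissibleSequences_step he
    exact ⟨u', c', h1, Or.inr h2⟩

/-- There are only finitely many possible first blocks, so a limit of concatenations again starts
with a block followed by a limit of concatenations; coinduction applies to the closure. -/
theorem isClosed_admissibleSequences : IsClosed (admissibleSequences s) := by
  refine isClosed_of_closure_subset (admissibleSequences_of_coinduction fun d hd => ?_)
  have hsub : admissibleSequences s ⊆ ⋃ p : Fin s × Fin s,
      {d | StartsWithBlock p.1 p.2 d} ∩
        (fun (d : ℕ → Fin s) k => d (k + p.2)) ⁻¹' closure (admissibleSequences s) := by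
    intro e he
    obtain ⟨u, c, h1, h2⟩ := admissibleSequences_step he
    exact Set.mem_iUnion.2 ⟨(u, c), h1, subset_closure h2⟩
  have hclosed : IsClosed (⋃ p : Fin s × Fin s,
      {d | StartsWithBlock p.1 p.2 d} ∩
        (fun (d : ℕ → Fin s) k => d (k + p.2)) ⁻¹' closure (admissibleSequences s)) := by
    refine isClosed_iUnion_of_finite fun p => IsClosed.inter ?_
      (isClosed_closure.preimage (by fun_prop))
    have hset : {d | StartsWithBlock p.1 p.2 d} =
        {_d : ℕ → Fin s | (p.2 : ℕ) ≠ 0 ∧ p.2 ≠ p.1} ∩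
          ((⋂ i, ⋂ _ : i + 1 < (p.2 : ℕ), {d : ℕ → Fin s | d i = p.1}) ∩
            {d | d ((p.2 : ℕ) - 1) = p.2}) := by
      ext d
      simp [StartsWithBlock, and_assoc]
    rw [hset]
    refine isClosed_const.inter (IsClosed.inter ?_ ?_)
    · exact isClosed_iInter fun i => isClosed_iInter fun _ =>
        isClosed_eq (continuous_apply i) continuous_const
    · exact isClosed_eq (continuous_apply _) continuous_const
  obtain ⟨p, h1, h2⟩ := Set.mem_iUnion.1 (closure_minimal hsub hclosed hd)
  exact ⟨p.1, p.2, h1, h2⟩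

theorem StartsWithBlock.eq_of_two_le {u c : Fin s} {d : ℕ → Fin s} (h : StartsWithBlock u c d)
    (hc : 2 ≤ (c : ℕ)) : d 0 = u := h.2.2.1 0 (by lia)

theorem StartsWithBlock.eq_of_eq_one {u c : Fin s} {d : ℕ → Fin s} (h : StartsWithBlock u c d)
    (hc : (c : ℕ) = 1) : d 0 = c := by
  have := h.2.2.2
  rwa [hc] at this

/-- A block of length at least two that starts with the digit `a` ends at the first digit
different from `a`. -/
theorem StartsWithBlock.eq_of_ne {u c a : Fin s} {d : ℕ → Fin s} (h : StartsWithBlock u c d)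
    (ha : d 0 = a) (hc : 2 ≤ (c : ℕ)) {m : ℕ} (hm : ∀ i < m, d i = a) (hne : d m ≠ a) :
    (c : ℕ) = m + 1 ∧ d m = c := by
  have hu : u = a := (h.eq_of_two_le hc).symm.trans ha
  obtain ⟨-, hcu, h1, h2⟩ := h
  rcases lt_trichotomy (m + 1) (c : ℕ) with hlt | heq | hgt
  · exact absurd ((h1 m hlt).trans hu) hne
  · exact ⟨heq.symm, by rw [← h2, ← heq]; rfl⟩
  · exact absurd (h2.symm.trans (hm _ (by lia))) (hu ▸ hcu)

/-- The only block of length one is the digit 1. -/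
theorem two_le_of_startsWithBlock {u c a : Fin s} {d : ℕ → Fin s} (h : StartsWithBlock u c d)
    (ha : d 0 = a) (ha1 : (a : ℕ) ≠ 1) : 2 ≤ (c : ℕ) := by
  by_contra hlt
  have h1 : (c : ℕ) = 1 := by have := h.1; lia
  exact ha1 (by rw [← ha, h.eq_of_eq_one h1, h1])

/-- The first block is `u…uc` with `u ≥ 2`. If `c ≥ 3`, the tail again starts with `u`, so its first
block runs up to the same final `c`; its length would be both `c - 1` and `c`. If `c = 2`, the tail
starts with 2 and its own tail is admissible too, so the argument repeats once. -/
theorem not_mem_admissibleSequences_tail {d : ℕ → Fin s} (hd : d ∈ admissibleSequences s)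
    (hd0 : 2 ≤ (d 0 : ℕ)) : (fun k => d (k + 1)) ∉ admissibleSequences s := by
  -- This treats `c ≥ 3` and leaves `c = 2` as a hypothesis, so that it can be applied to the
  -- sequence and then to its tail.
  have main : ∀ d ∈ admissibleSequences s, 2 ≤ (d 0 : ℕ) →
      (∀ u c : Fin s, StartsWithBlock u c d → (c : ℕ) = 2 →
        (fun k => d (k + 1)) ∈ admissibleSequences s →
        (fun k => d (k + 2)) ∉ admissibleSequences s) →
      (fun k => d (k + 1)) ∉ admissibleSequences s := by
    intro d hd hd0 h2 ht
    obtain ⟨u, c, hb, hct⟩ := admissibleSequences_step hd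
    have hc := two_le_of_startsWithBlock hb rfl (by lia)
    rcases hc.eq_or_lt with hc2 | hc3
    · exact h2 u c hb hc2.symm ht (by rwa [← hc2] at hct)
    · have hu := hb.eq_of_two_le hc
      obtain ⟨u', c', hb', -⟩ := admissibleSequences_step ht
      obtain ⟨-, hcu, h1, hlast⟩ := hb
      have h10 : d (0 + 1) = d 0 := by rw [h1 (0 + 1) (by lia), hu]
      have hc' := two_le_of_startsWithBlock hb' h10 (by lia)
      have hidx : (c : ℕ) - 2 + 1 = c - 1 := by lia
      obtain ⟨e1, e2⟩ := hb'.eq_of_ne (m := (c : ℕ) - 2) h10 hc'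
        (fun i hi => by rw [h1 (i + 1) (by lia), hu])
        (by rw [hidx, hlast, hu]; exact hcu)
      rw [hidx, hlast] at e2
      rw [← e2] at e1
      lia
  refine main d hd hd0 fun u c hb hc ht hct => ?_
  have h1 : d (0 + 1) = c := by
    have := hb.2.2.2
    rwa [hc] at this
  refine main _ ht (by rw [h1]; exact hc.ge) (fun u' c' hb' hc' _ _ => ?_) hct
  -- On the second round the first block would be `22`, excluded by `c ≠ u`.
  refine hb'.2.1 (Fin.ext ?_)
  rw [← hb'.eq_of_two_le hc'.ge, h1, hc, hc']

/-- Suppose a longer first block is also possible. A shorter block of length at least 2 has the same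
repeated digit, which its last digit would then have to equal. If the shorter block is `1`, the
longer is `1…1c'`; reading its ones singly shows that the sequences starting at `c'` and just after
it are both admissible, which is impossible as `c' ≥ 2`. -/
theorem StartsWithBlock.length_le_of_mem {d : ℕ → Fin s} {u c u' c' : Fin s}
    (h : StartsWithBlock u c d) (ht : (fun k => d (k + c)) ∈ admissibleSequences s)
    (h' : StartsWithBlock u' c' d) (ht' : (fun k => d (k + c')) ∈ admissibleSequences s) :
    (c' : ℕ) ≤ c := by
  by_contra! hlt
  have hc0 := h.1
  have hu' := h'.eq_of_two_le (by lia)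
  rcases (show (c : ℕ) = 1 ∨ 2 ≤ (c : ℕ) by lia) with hc | hc
  · have hd0 : d 0 = c := h.eq_of_eq_one hc
    have hcu' : u' = c := hu'.symm.trans hd0
    have hrun : ∀ i, i + 1 < (c' : ℕ) → d i = c := fun i hi => (h'.2.2.1 i hi).trans hcu'
    have hlast : d ((c' : ℕ) - 1) = c' := h'.2.2.2
    have hcc' : c' ≠ c := fun e => by rw [e] at hlt; exact lt_irrefl _ hlt
    have hmem : ∀ j, 1 ≤ j → j + 1 ≤ (c' : ℕ) →
        (fun k => d (k + j)) ∈ admissibleSequences s := by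
      intro j hj
      induction j, hj using Nat.le_induction with
      | base => intro _; rwa [hc] at ht
      | succ j hj ih =>
        intro hj'
        obtain ⟨v, e, hb, hbt⟩ := admissibleSequences_step (ih (by lia))
        have hd1 : d (0 + j) = c := hrun _ (by lia)
        rcases (show (e : ℕ) = 1 ∨ 2 ≤ (e : ℕ) by have := hb.1; lia) with he | he
        · rw [he] at hbt
          simpa only [add_assoc, Nat.add_comm 1 j] using hbt
        -- A longer block starting at position `j` would end at the same `c'` and so have length `c'
        -- - j`, whereas its last digit forces length `c'`; but `j ≥ 1`.
        · have hidx : (c' : ℕ) - 1 - j + j = c' - 1 := by lia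
          obtain ⟨e1, e2⟩ := hb.eq_of_ne (m := (c' : ℕ) - 1 - j) hd1 he
            (fun i hi => hrun _ (by lia)) (by rw [hidx, hlast]; exact hcc')
          rw [hidx, hlast] at e2
          rw [← e2] at e1
          lia
    refine not_mem_admissibleSequences_tail (hmem (c' - 1) (by lia) (by lia)) ?_ ?_
    · rw [zero_add, hlast]; lia
    · convert ht' using 3
      lia
  · have hu := h.eq_of_two_le hc
    refine h.2.1 ?_
    rw [← h.2.2.2, ← hu, hu']
    exact h'.2.2.1 _ (by lia)

/-- Every block ends in a nonzero digit. -/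
theorem exists_ne_zero_of_mem_admissibleSequences (n : ℕ) :
    ∀ d ∈ admissibleSequences s, ∃ m, n ≤ m ∧ (d m : ℕ) ≠ 0 := by
  induction n using Nat.strong_induction_on with
  | _ n ih =>
    intro d hd
    obtain ⟨u, c, hb, ht⟩ := admissibleSequences_step hd
    have hc := hb.1
    rcases lt_or_ge n (c : ℕ) with h | h
    · exact ⟨c - 1, by lia, by rw [hb.2.2.2]; exact hc⟩
    · obtain ⟨m, hm, hne⟩ := ih (n - c) (by lia) _ ht
      exact ⟨m + c, by lia, hne⟩

/-! ### From digit sequences to real numbers -/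

theorem ofDigits_pos {d : ℕ → Fin s} {m : ℕ} (hm : (d m : ℕ) ≠ 0) : 0 < Real.ofDigits d := by
  refine Real.summable_ofDigitsTerm.tsum_pos (fun _ => Real.ofDigitsTerm_nonneg) m ?_
  have h1 : 0 < s := (d 0).pos
  have h2 : 0 < (d m : ℕ) := Nat.pos_of_ne_zero hm
  rw [Real.ofDigitsTerm]
  positivity

/-- The digit sequences that are not eventually zero are determined by their values. -/
theorem eq_of_ofDigits_eq {d d' : ℕ → Fin s} (hd : ∀ n, ∃ m, n ≤ m ∧ (d m : ℕ) ≠ 0)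
    (hd' : ∀ n, ∃ m, n ≤ m ∧ (d' m : ℕ) ≠ 0) (h : Real.ofDigits d = Real.ofDigits d') :
    d = d' := by
  have hs : (0 : ℝ) < s := Nat.cast_pos.2 (d 0).pos
  have htail : ∀ e : ℕ → Fin s, (∀ n, ∃ m, n ≤ m ∧ (e m : ℕ) ≠ 0) →
      ∀ n, 0 < Real.ofDigits fun k => e (k + n) := by
    intro e he n
    obtain ⟨m, hm, hne⟩ := he n
    exact ofDigits_pos (m := m - n) (by rwa [Nat.sub_add_cancel hm])
  have hstep : ∀ e : ℕ → Fin s, ∀ n, (s : ℝ) * Real.ofDigits (fun k => e (k + n)) =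
      (e n : ℕ) + Real.ofDigits fun k => e (k + (n + 1)) := by
    intro e n
    rw [Real.ofDigits_eq_sum_add_ofDigits _ 1]
    simp only [Finset.sum_range_one, Real.ofDigitsTerm, zero_add, pow_one, add_assoc,
      Nat.add_comm 1 n]
    field_simp
  have key : ∀ n, (Real.ofDigits fun k => d (k + n)) = (Real.ofDigits fun k => d' (k + n)) ∧
      ∀ k < n, d k = d' k := by
    intro n
    induction n with
    | zero => simpa using h
    | succ n ih =>
      have e1 := hstep d n
      have e2 := hstep d' n
      rw [ih.1, e2] at e1
      have p1 := htail d hd (n + 1)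
      have p2 := htail d' hd' (n + 1)
      have q1 := Real.ofDigits_le_one fun k => d (k + (n + 1))
      have q2 := Real.ofDigits_le_one fun k => d' (k + (n + 1))
      -- Both remainders lie in the half-open interval `(0, 1]`, so the integer digits differ by
      -- less than 1.
      have a1 : (d n : ℕ) < (d' n : ℕ) + 1 := by
        have : ((d n : ℕ) : ℝ) < (d' n : ℕ) + 1 := by linarith
        exact_mod_cast this
      have a2 : (d' n : ℕ) < (d n : ℕ) + 1 := by
        have : ((d' n : ℕ) : ℝ) < (d n : ℕ) + 1 := by linarith
        exact_mod_cast this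
      have a3 : d n = d' n := Fin.ext (by lia)
      refine ⟨by rw [a3] at e1; linarith, fun k hk => ?_⟩
      rcases (show k < n ∨ k = n by lia) with hk | rfl
      · exact ih.2 k hk
      · exact a3
  exact funext fun n => (key (n + 1)).2 n n.lt_succ_self

/-! ### The generating similarities and their disjoint images -/

theorem startsWithBlock_prependBlock {u c : Fin s} (hc : (c : ℕ) ≠ 0) (hcu : c ≠ u)
    (d : ℕ → Fin s) : StartsWithBlock u c (prependBlock u c d) := by
  refine ⟨hc, hcu, fun i hi => if_pos hi, ?_⟩
  have : (c : ℕ) - 1 + 1 = c := by lia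
  simp [prependBlock, this]

theorem prependBlock_add (u c : Fin s) (d : ℕ → Fin s) :
    (fun k => prependBlock u c d (k + c)) = d := by
  funext k
  have h1 : ¬ k + (c : ℕ) + 1 < c := by lia
  have h2 : ¬ k + (c : ℕ) + 1 = c := by lia
  simp only [prependBlock, h1, h2, if_false, Nat.add_sub_cancel]

/-- The effect on values of prepending the block `u…uc`. -/
noncomputable def blockMap (u c : Fin s) (x : ℝ) : ℝ :=
  -- Only the first `c` digits enter the sum; the constant continuation is an arbitrary filler.
  (∑ i ∈ Finset.range c, Real.ofDigitsTerm (prependBlock u c fun _ => c) i) +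
    ((s : ℝ) ^ (c : ℕ))⁻¹ * x

theorem StartsWithBlock.ofDigits_eq {u c : Fin s} {d : ℕ → Fin s} (h : StartsWithBlock u c d) :
    Real.ofDigits d = blockMap u c (Real.ofDigits fun k => d (k + c)) := by
  rw [Real.ofDigits_eq_sum_add_ofDigits d c, blockMap]
  congr 1
  refine Finset.sum_congr rfl fun i hi => ?_
  have hi' := Finset.mem_range.1 hi
  rw [Real.ofDigitsTerm, Real.ofDigitsTerm]
  congr 3
  rcases (show i + 1 < (c : ℕ) ∨ i + 1 = c by lia) with h1 | h1
  · rw [h.2.2.1 i h1, prependBlock, if_pos h1]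
  · have h2 : i = (c : ℕ) - 1 := by lia
    rw [prependBlock, if_neg (by lia), if_pos h1, h2, h.2.2.2]

theorem dist_blockMap (u c : Fin s) (x y : ℝ) :
    dist (blockMap u c x) (blockMap u c y) = ((s : ℝ) ^ (c : ℕ))⁻¹ * dist x y := by
  rw [blockMap, blockMap, dist_add_left, Real.dist_eq, Real.dist_eq, ← mul_sub, abs_mul,
    abs_of_nonneg (by positivity)]

/-- The pairs `(u, c)` indexing the different admissible blocks `u…uc`; the block `c = 1`
does not depend on `u`. -/
abbrev BlockIndex (s : ℕ) : Type :=
  {p : Fin s × Fin s // (p.2 : ℕ) ≠ 0 ∧ p.2 ≠ p.1 ∧ ((p.2 : ℕ) = 1 → (p.1 : ℕ) = 0)}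

theorem tildeS_eq_image (s : ℕ) : tildeS s = Real.ofDigits '' admissibleSequences s := by
  ext x
  exact ⟨fun ⟨d, hd, hx⟩ => ⟨d, hd, hx.symm⟩, fun ⟨d, hd, hx⟩ => ⟨d, hd, hx.symm⟩⟩

theorem isCompact_tildeS (s : ℕ) : IsCompact (tildeS s) := by
  rw [tildeS_eq_image]
  exact isClosed_admissibleSequences.isCompact.image Real.continuous_ofDigits

theorem tildeS_nonempty (hs : 2 ≤ s) : (tildeS s).Nonempty := by
  rw [tildeS_eq_image]
  refine Set.Nonempty.image _ ⟨fun _ => ⟨1, hs⟩, admissibleSequences_of_coinduction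
    (P := {fun _ => (⟨1, hs⟩ : Fin s)}) ?_ (Set.mem_singleton _)⟩
  rintro _ rfl
  exact ⟨⟨0, by lia⟩, ⟨1, hs⟩, ⟨by simp, by simp, fun i hi => by simp at hi, rfl⟩, rfl⟩

theorem tildeS_eq_iUnion (s : ℕ) :
    tildeS s = ⋃ p : BlockIndex s, blockMap p.1.1 p.1.2 '' tildeS s := by
  refine Set.Subset.antisymm ?_ (Set.iUnion_subset ?_)
  · rintro _ ⟨d, hd, rfl⟩
    obtain ⟨u, c, hb, ht⟩ := admissibleSequences_step hd
    by_cases hc : (c : ℕ) = 1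
    -- For `c = 1` the repeated digit does not occur in the block, so it may be normalised to 0.
    · have hb' : StartsWithBlock ⟨0, u.pos⟩ c d :=
        ⟨hb.1, fun e => hb.1 (by rw [e]), fun i hi => by lia, hb.2.2.2⟩
      exact Set.mem_iUnion.2 ⟨⟨(⟨0, u.pos⟩, c), hb'.1, hb'.2.1, fun _ => rfl⟩,
        _, ⟨_, ht, rfl⟩, hb'.ofDigits_eq.symm⟩
    · exact Set.mem_iUnion.2 ⟨⟨(u, c), hb.1, hb.2.1, fun h => absurd h hc⟩,
        _, ⟨_, ht, rfl⟩, hb.ofDigits_eq.symm⟩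
  · rintro ⟨⟨u, c⟩, hc, hcu, -⟩ _ ⟨_, ⟨d, hd, rfl⟩, rfl⟩
    have hb := startsWithBlock_prependBlock hc hcu d
    have hd' := prependBlock_add u c d
    refine ⟨prependBlock u c d, admissibleSequences_of_step hb (by rw [hd']; exact hd), ?_⟩
    rw [hb.ofDigits_eq, hd']

/-- A common value has a single admissible digit sequence, and unique decoding then gives both
blocks the same length; the first digit recovers `u`, or the normalisation does when the length is
one. -/
theorem pairwise_disjoint_blockMap_image_tildeS (s : ℕ) :
    Pairwise fun p q : BlockIndex s =>
      Disjoint (blockMap p.1.1 p.1.2 '' tildeS s) (blockMap q.1.1 q.1.2 '' tildeS s) := by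
  rintro ⟨⟨u, c⟩, hc, hcu, h1⟩ ⟨⟨u', c'⟩, hc', hcu', h1'⟩ hne
  rw [Set.disjoint_left]
  rintro _ ⟨_, ⟨d, hd, rfl⟩, rfl⟩ ⟨_, ⟨d', hd', rfl⟩, heq⟩
  refine hne ?_
  dsimp only at *
  have hb := startsWithBlock_prependBlock hc hcu d
  have hb' := startsWithBlock_prependBlock hc' hcu' d'
  have ht := prependBlock_add u c d
  have ht' := prependBlock_add u' c' d'
  have hm : prependBlock u c d ∈ admissibleSequences s :=
    admissibleSequences_of_step hb (by rw [ht]; exact hd)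
  have hm' : prependBlock u' c' d' ∈ admissibleSequences s :=
    admissibleSequences_of_step hb' (by rw [ht']; exact hd')
  have e : prependBlock u' c' d' = prependBlock u c d := by
    refine eq_of_ofDigits_eq (fun n => exists_ne_zero_of_mem_admissibleSequences n _ hm')
      (fun n => exists_ne_zero_of_mem_admissibleSequences n _ hm) ?_
    rw [hb.ofDigits_eq, hb'.ofDigits_eq, ht, ht']
    exact heq
  rw [e] at hb' ht'
  have mt : (fun k => prependBlock u c d (k + c)) ∈ admissibleSequences s := by
    rw [ht]; exact hd
  have mt' : (fun k => prependBlock u c d (k + c')) ∈ admissibleSequences s := by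
    rw [ht']; exact hd'
  have hcc : c = c' := Fin.ext (le_antisymm (hb'.length_le_of_mem mt' hb mt)
    (hb.length_le_of_mem mt hb' mt'))
  subst hcc
  have huu : u = u' := by
    by_cases h : (c : ℕ) = 1
    · exact Fin.ext ((h1 h).trans (h1' h).symm)
    · exact (hb.eq_of_two_le (by lia)).symm.trans (hb'.eq_of_two_le (by lia))
  subst huu
  rfl

end Blocks

/-! ### Counting blocks and solving the dimension equation -/

theorem sum_blockIndex {s : ℕ} (hs : 2 ≤ s) (g : ℕ → ℝ) :
    ∑ p : BlockIndex s, g p.1.2 = g 1 + ∑ k ∈ Finset.Icc 2 (s - 1), ((s : ℝ) - 1) * g k := by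
  classical
  have h1 : ∑ p : BlockIndex s, g p.1.2 = ∑ c : Fin s, ∑ u : Fin s,
      if (c : ℕ) ≠ 0 ∧ c ≠ u ∧ ((c : ℕ) = 1 → (u : ℕ) = 0) then g c else 0 := by
    rw [← Finset.sum_subtype (Finset.univ.filter fun p : Fin s × Fin s =>
      (p.2 : ℕ) ≠ 0 ∧ p.2 ≠ p.1 ∧ ((p.2 : ℕ) = 1 → (p.1 : ℕ) = 0)) (by simp) fun p => g p.2,
      Finset.sum_filter, Fintype.sum_prod_type_right]
  have h2 : ∀ c : Fin s, (∑ u : Fin s,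
      if (c : ℕ) ≠ 0 ∧ c ≠ u ∧ ((c : ℕ) = 1 → (u : ℕ) = 0) then g c else 0) =
      (fun k : ℕ => if k = 0 then 0 else if k = 1 then g 1 else ((s : ℝ) - 1) * g k) c := by
    intro c
    dsimp only
    split_ifs with h0 h1
    · simp [h0]
    · rw [Finset.sum_eq_single ⟨0, by lia⟩]
      · have : c ≠ ⟨0, by lia⟩ := fun e => h0 (by rw [e])
        simp [h1, this]
      · intro u _ hu
        rw [if_neg]
        rintro ⟨-, -, h⟩
        exact hu (Fin.ext (h h1))
      · simp
    · have : ∀ u : Fin s, ((c : ℕ) ≠ 0 ∧ c ≠ u ∧ ((c : ℕ) = 1 → (u : ℕ) = 0)) ↔ c ≠ u :=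
        fun u => ⟨fun h => h.2.1, fun h => ⟨h0, h, fun h' => absurd h' h1⟩⟩
      simp only [this]
      rw [← Finset.sum_filter, Finset.filter_ne, Finset.sum_const,
        Finset.card_erase_of_mem (Finset.mem_univ _), Finset.card_fin, nsmul_eq_mul,
        Nat.cast_sub (by lia), Nat.cast_one]
  have h3 : Finset.range s = insert 0 (insert 1 (Finset.Icc 2 (s - 1))) := by
    ext k
    simp only [Finset.mem_range, Finset.mem_insert, Finset.mem_Icc]
    lia
  rw [h1, Finset.sum_congr rfl fun c _ => h2 c, Fin.sum_univ_eq_sum_range (fun k : ℕ =>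
    if k = 0 then 0 else if k = 1 then g 1 else ((s : ℝ) - 1) * g k), h3,
    Finset.sum_insert (by simp), Finset.sum_insert (by simp)]
  simp only [if_true, one_ne_zero, if_false, zero_add]
  congr 1
  refine Finset.sum_congr rfl fun k hk => ?_
  have := (Finset.mem_Icc.1 hk).1
  rw [if_neg (by lia), if_neg (by lia)]

theorem sum_Icc_inv_pow {s : ℝ} (hs : s ≠ 0) (n : ℕ) :
    ∑ k ∈ Finset.Icc 2 (n + 1), (s - 1) * s⁻¹ ^ k = s⁻¹ - s⁻¹ ^ (n + 1) := by
  induction n with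
  | zero => simp
  | succ n ih =>
    rw [Finset.sum_Icc_succ_top (by lia), ih]
    linear_combination s⁻¹ ^ (n + 1) * mul_inv_cancel₀ hs

/-- Intermediate values on `[1/s, 1]`: by telescoping, the left side at `1/s` is `2/s - s^(-(s-1))`,
below 1 because `s ≥ 3`, and at 1 it exceeds 1. -/
theorem exists_root_dimension_equation {s : ℕ} (hs : 2 < s) :
    ∃ x : ℝ, (s : ℝ)⁻¹ < x ∧ x < 1 ∧
      x + ∑ k ∈ Finset.Icc 2 (s - 1), ((s : ℝ) - 1) * x ^ k = 1 := by
  have hs' : (3 : ℝ) ≤ s := by exact_mod_cast hs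
  have hinv : (s : ℝ)⁻¹ ≤ 1 / 3 := by
    rw [inv_le_comm₀ (by linarith) (by norm_num)]; norm_num; exact_mod_cast hs
  have hcont : ContinuousOn (fun x : ℝ => x + ∑ k ∈ Finset.Icc 2 (s - 1), ((s : ℝ) - 1) * x ^ k)
      (Set.Icc (s : ℝ)⁻¹ 1) := by fun_prop
  obtain ⟨x, ⟨hx1, hx2⟩, hx⟩ := intermediate_value_Ioo (by linarith) hcont (show (1 : ℝ) ∈ _ by
    refine ⟨?_, ?_⟩
    · obtain ⟨n, rfl⟩ : ∃ n, s = n + 2 := ⟨s - 2, by lia⟩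
      rw [show n + 2 - 1 = n + 1 by lia, sum_Icc_inv_pow (by linarith)]
      have : 0 < ((n + 2 : ℕ) : ℝ)⁻¹ ^ (n + 1) := by positivity
      linarith
    · have : 0 < ∑ k ∈ Finset.Icc 2 (s - 1), ((s : ℝ) - 1) * 1 ^ k :=
        Finset.sum_pos (fun k _ => by rw [one_pow]; linarith) ⟨2, by simp; lia⟩
      linarith)
  exact ⟨x, hx1, hx2, hx⟩

theorem exists_dimension {s : ℕ} (hs : 2 < s) :
    ∃ α : ℝ≥0, 0 < α ∧ α < 1 ∧
      (1 / (s : ℝ)) ^ (α : ℝ) + ∑ k ∈ Finset.Icc 2 (s - 1),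
        ((s : ℝ) - 1) * (1 / (s : ℝ)) ^ ((k : ℝ) * (α : ℝ)) = 1 := by
  obtain ⟨x, hx1, hx2, hx⟩ := exists_root_dimension_equation hs
  have hs1 : (1 : ℝ) < s := by exact_mod_cast (by lia : 1 < s)
  have hs0 : (0 : ℝ) < s := by linarith
  have hx0 : 0 < x := (inv_pos.2 hs0).trans hx1
  -- The exponent is chosen so that `s^(-α) = x`; the bounds `1/s < x < 1` become `0 < α < 1`.
  have hα0 : 0 < Real.logb s x⁻¹ := Real.logb_pos hs1 ((one_lt_inv₀ hx0).2 hx2)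
  have hα1 : Real.logb s x⁻¹ < 1 := by
    rw [Real.logb_lt_iff_lt_rpow hs1 (inv_pos.2 hx0), Real.rpow_one]
    exact (inv_lt_comm₀ hs0 hx0).1 hx1
  have hpow : (1 / (s : ℝ)) ^ Real.logb s x⁻¹ = x := by
    rw [one_div, Real.inv_rpow hs0.le, Real.rpow_logb hs0 hs1.ne' (inv_pos.2 hx0), inv_inv]
  obtain ⟨α, hα⟩ : ∃ α : ℝ≥0, (α : ℝ) = Real.logb s x⁻¹ := ⟨⟨_, hα0.le⟩, rfl⟩
  rw [← hα] at hα0 hα1 hpow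
  refine ⟨α, hα0, hα1, Eq.trans ?_ hx⟩
  rw [hpow]
  congr 1
  refine Finset.sum_congr rfl fun k _ => ?_
  rw [mul_comm (k : ℝ), Real.rpow_mul_natCast (by positivity), hpow]

/-! ### Self-similarity and fractality -/

theorem isSelfSimilar_of_ifs {I : Type*} [Fintype I] [Nontrivial I] {f : I → ℝ → ℝ} {r : I → ℝ}
    {K : Set ℝ} (hr : ∀ i, 0 < r i ∧ r i < 1)
    (hf : ∀ i x y, dist (f i x) (f i y) = r i * dist x y) (hKc : IsCompact K) (hKn : K.Nonempty)
    (hK : K = ⋃ i, f i '' K) (hdisj : Pairwise fun i j => Disjoint (f i '' K) (f j '' K))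
    (hpos : 0 < Measure.hausdorffMeasure (dimH K).toReal K) : IsSelfSimilar K := by
  let e := Fintype.equivFin I
  refine ⟨hKn, hKc, Fintype.card I, fun i => f (e.symm i), fun i => r (e.symm i),
    Fintype.one_lt_card, fun i => hr _, fun i => hf _, ?_, hpos, fun i j hij => ?_⟩
  · rw [e.symm.surjective.iUnion_comp fun i => f i '' K]
    exact hK
  · rw [(hdisj (e.symm.injective.ne hij)).inter_eq, measure_empty]

theorem isFractalNarrow_of_dimH {K : Set ℝ} {α : ℝ≥0} (h : dimH K = α) (h0 : 0 < α) (h1 : α < 1) :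
    IsFractalNarrow K := by
  refine ⟨h ▸ ENNReal.coe_ne_top, fun n hn => ?_⟩
  rw [h] at hn
  have hn' : α = n := by exact_mod_cast hn
  rw [hn'] at h0 h1
  have : 0 < n := by exact_mod_cast h0
  have : n < 1 := by exact_mod_cast h1
  lia

/-- A topological dimension is `⊥`, a natural number or `∞`, and a finite non-integral Hausdorff
dimension is none of these. -/
theorem IsFractalNarrow.isFractalWide {K : Set ℝ} (h : IsFractalNarrow K) : IsFractalWide K := by
  intro he
  induction hd : smallInductiveDimension K using WithBot.recBotCoe with
  | bot => rw [hd] at he; exact absurd he (by simp)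
  | coe d =>
    rw [hd, WithBot.map_coe, WithBot.coe_inj] at he
    induction d using ENat.recTopCoe with
    | top => exact h.1 (by simpa using he.symm)
    | coe n => exact h.2 n (by simpa using he.symm)

theorem nontrivial_blockIndex {s : ℕ} (hs : 2 < s) : Nontrivial (BlockIndex s) := by
  refine ⟨⟨(⟨0, by lia⟩, ⟨1, by lia⟩), by simp, by simp, by simp⟩,
    ⟨(⟨0, by lia⟩, ⟨2, hs⟩), by simp, by simp, by simp⟩, by simp⟩

theorem theorem5 (s : ℕ) (hs : 2 < s) :
    IsSelfSimilar (tildeS s) ∧ IsFractalWide (tildeS s) ∧ IsFractalNarrow (tildeS s) ∧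
      ∃ α₀ : ℝ≥0, dimH (tildeS s) = (α₀ : ℝ≥0∞) ∧
        (1 / (s : ℝ)) ^ (α₀ : ℝ) +
          ∑ k ∈ Finset.Icc 2 (s - 1), ((s : ℝ) - 1) * (1 / (s : ℝ)) ^ ((k : ℝ) * (α₀ : ℝ)) = 1 := by
  obtain ⟨α, hα0, hα1, hα⟩ := exists_dimension hs
  have hs1 : (1 : ℝ) < s := by exact_mod_cast (by lia : 1 < s)
  have hs0 : (0 : ℝ) < s := by linarith
  have := nontrivial_blockIndex hs
  have hr : ∀ p : BlockIndex s,
      0 < ((s : ℝ) ^ (p.1.2 : ℕ))⁻¹ ∧ ((s : ℝ) ^ (p.1.2 : ℕ))⁻¹ < 1 := fun p =>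
    ⟨by positivity, inv_lt_one_of_one_lt₀ (one_lt_pow₀ hs1 p.2.1)⟩
  have hf : ∀ (p : BlockIndex s) (x y : ℝ), dist (blockMap p.1.1 p.1.2 x) (blockMap p.1.1 p.1.2 y)
      = ((s : ℝ) ^ (p.1.2 : ℕ))⁻¹ * dist x y := fun p => dist_blockMap _ _
  have hsum : ∑ p : BlockIndex s, (((s : ℝ) ^ (p.1.2 : ℕ))⁻¹) ^ (α : ℝ) = 1 := by
    rw [sum_blockIndex hs.le fun k => (((s : ℝ) ^ k)⁻¹) ^ (α : ℝ)]
    refine Eq.trans ?_ hα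
    congr 1
    · simp
    · refine Finset.sum_congr rfl fun k _ => ?_
      rw [Real.rpow_mul (by positivity), Real.rpow_natCast, one_div, inv_pow]
  have hKn := tildeS_nonempty hs.le
  obtain ⟨hdim, hpos⟩ := dimH_eq_of_ifs (fun p => (hr p).1) (fun p => (hr p).2) hf
    (isCompact_tildeS s) hKn (tildeS_eq_iUnion s) (pairwise_disjoint_blockMap_image_tildeS s)
    hα0 hsum
  have hnarrow := isFractalNarrow_of_dimH hdim hα0 hα1
  refine ⟨isSelfSimilar_of_ifs hr hf (isCompact_tildeS s) hKn (tildeS_eq_iUnion s)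
    (pairwise_disjoint_blockMap_image_tildeS s) ?_, hnarrow.isFractalWide, hnarrow,
    α, hdim, hα⟩
  rw [hdim]
  exact hpos
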